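/- Let $\mathcal H$ and $\mathcal K$ be complex Hilbert spaces and let $S$ be a closed, densely defined, symmetric operator in $\mathcal H$ with equal (possibly infinite) defect numbers. Let $(\mathcal K,\Gamma_0,\Gamma_1)$ be a boundary triplet for $S^*$; that is, $\Gamma_0,\Gamma_1\colon \operatorname{dom}(S^*)\to\mathcal K$ are linear maps such that $\boldsymbol\Gamma f:=(\Gamma_0f,\Gamma_1f)$ maps $\operatorname{dom}(S^*)$ onto $\mathcal K\oplus\mathcal K$ and $$\langle f,S^*g\rangle_{\mathcal H}-\langle S^*f,g\rangle_{\mathcal H}=\langle\Gamma_0f,\Gamma_1g\rangle_{\mathcal K}-\langle\Gamma_1f,\Gamma_0g\rangle_{\mathcal K}\qquad\text{for all } f,g\in\operatorname{dom}(S^*).$$ For $z\in\mathbb C$ let $\mathcal M(z):=\boldsymbol\Gamma\big(\ker(S^*-z)\big)\subset\mathcal K\oplus\mathcal K$, and let $$\Phi_-(S^*):=\{z\in\mathbb C:\ \dim\big(\mathcal H/\operatorname{ran}(S^*-z)\big)<\infty\}.$$ Then for every $z_0\in\Phi_-(S^*)$ there are an open neighbourhood $U\subset\mathbb C$ of $z_0$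 and a family of bounded operators $G_z\in\mathcal B(\mathcal K\oplus\mathcal K)$, $z\in U$, depending analytically on $z\in U$ in the operator norm, such that every $G_z$ is invertible in $\mathcal B(\mathcal K\oplus\mathcal K)$, $G_{z_0}=I_{\mathcal K\oplus\mathcal K}$, and $G_z\,\mathcal M(z_0)=\mathcal M(z)$ for all $z\in U$. (It is not assumed that $\ker(S-z)=0$ for any $z$.) -/

import Mathlib

open scoped LinearPMap

noncomputable section

namespace CauchyData

universe u v

variable {H : Type u} [NormedAddCommGroup H] [InnerProductSpace ℂ H]

/-- The operator `T - z`, as a linear map on the domain of `T`. -/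
def subScalar (T : H →ₗ.[ℂ] H) (z : ℂ) : T.domain →ₗ[ℂ] H :=
  T.toFun - z • T.domain.subtype

/-- `Φ₋(T)`: the set of those `z` for which the deficiency of `T - z`, that is, the codimension
of the range of `T - z`, is finite. -/
def PhiMinus (T : H →ₗ.[ℂ] H) : Set ℂ :=
  {z | FiniteDimensional ℂ (H ⧸ LinearMap.range (subScalar T z))}

/-- The defect space of `S` at `z`: the orthogonal complement of the range of `S - z`. -/
def defectSpace (S : H →ₗ.[ℂ] H) (z : ℂ) : Submodule ℂ H :=
  (LinearMap.range (subScalar S z))ᗮ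

/-- The (possibly infinite) defect numbers of `S`, i.e. the Hilbert space dimensions of the
orthogonal complements of the ranges of `S + i` and `S - i`, coincide: both spaces have
orthonormal bases indexed by the same type. -/
def EqualDefectNumbers (S : H →ₗ.[ℂ] H) : Prop :=
  ∃ ι : Type u, Nonempty (HilbertBasis ι ℂ (defectSpace S (-Complex.I))) ∧
    Nonempty (HilbertBasis ι ℂ (defectSpace S Complex.I))

/-- The Hilbert space direct sum `K ⊕ K`. -/
abbrev DirectSum2 (K : Type v) : Type v := WithLp 2 (K × K)

variable [CompleteSpace H]

/-- Boundary triplets `(K, Γ₀, Γ₁)` for the adjoint of a (densely defined, symmetric)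
operator `S`, with boundary space `K`. -/
structure BoundaryTriplet (S : H →ₗ.[ℂ] H)
    (K : Type v) [NormedAddCommGroup K] [InnerProductSpace ℂ K] where
  /-- the first boundary map -/
  Γ₀ : S†.domain →ₗ[ℂ] K
  /-- the second boundary map -/
  Γ₁ : S†.domain →ₗ[ℂ] K
  /-- the combined boundary map `f ↦ (Γ₀ f, Γ₁ f)` is onto -/
  surjective : ∀ a b : K, ∃ f : S†.domain, Γ₀ f = a ∧ Γ₁ f = b
  /-- the abstract Green identity -/
  green : ∀ f g : S†.domain,
    inner ℂ (f : H) (S† g) - inner ℂ (S† f) (g : H) =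
      inner ℂ (Γ₀ f) (Γ₁ g) - inner ℂ (Γ₁ f) (Γ₀ g)

namespace BoundaryTriplet

variable {S : H →ₗ.[ℂ] H} {K : Type v} [NormedAddCommGroup K] [InnerProductSpace ℂ K]

/-- The trace operator `f ↦ (Γ₀ f, Γ₁ f)` from the domain of `S*` to `K ⊕ K`. -/
def trace (B : BoundaryTriplet S K) : S†.domain →ₗ[ℂ] DirectSum2 K :=
  (WithLp.linearEquiv 2 ℂ (K × K)).symm.toLinearMap ∘ₗ B.Γ₀.prod B.Γ₁

/-- The Cauchy data space at `z`: the image of the kernel of `S* - z` under the trace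
operator. -/
def cauchyDataSpace (B : BoundaryTriplet S K) (z : ℂ) : Submodule ℂ (DirectSum2 K) :=
  (LinearMap.ker (subScalar S† z)).map B.trace

end BoundaryTriplet

end CauchyData

end

/-! Put `V = ran(S* - z₀)`, closed because its codimension is finite. Since `S** = S`, a vector
orthogonal to `V` lies in `ker(S - conj z₀)`, and by symmetry also in `ker(S - z₀)`. So `Vᗮ`
consists of eigenvectors of `S`, on which the trace vanishes, and the Cauchy data are unchanged when
`S*` is cut down to `V` (`cauchyDataSpace_eq_map_ker`). The reduced operator `A` is onto `V`, even
if `z₀` is an eigenvalue of `S`.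

With a right inverse `R` of `A` and the inclusion `J`, one has `A - (z - z₀) J = A W(z)` for `W(z) =
1 - (z - z₀) R J`, so near `z₀` the kernels are `W(z)⁻¹ ker A`. The reduced trace `Γ` is bounded
below on `ker A` (`exists_norm_le_mul_norm_reducedTrace`), hence has a left inverse `L` there, and
`G(z) = 1 + Γ (W(z)⁻¹ - 1) L` transports the Cauchy data (`exists_analytic_transport_ker`). -/

namespace ContinuousLinearMap

/-! ### Bounded operators on Hilbert spaces and kernels of affine pencils. -/

section Hilbert

variable {X Y : Type*} [NormedAddCommGroup X] [InnerProductSpace ℂ X] [CompleteSpace X]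
  [NormedAddCommGroup Y] [NormedSpace ℂ Y]

/-- Every value of a bounded operator on a Hilbert space is attained on the orthogonal complement
of the kernel. -/
theorem exists_mem_orthogonal_ker_apply_eq (f : X →L[ℂ] Y) (x : X) :
    ∃ y ∈ f.kerᗮ, f y = f x := by
  have : CompleteSpace f.ker := f.isClosed_ker.completeSpace_coe
  obtain ⟨k, hk, y, hy, rfl⟩ := f.ker.exists_add_mem_mem_orthogonal x
  refine ⟨y, hy, ?_⟩
  have : f k = 0 := hk
  simp [this]

omit [CompleteSpace X] in
theorem ker_comp_subtypeL_orthogonal_ker (f : X →L[ℂ] Y) :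
    (f ∘L f.kerᗮ.subtypeL).ker = ⊥ := by
  rw [LinearMap.ker_eq_bot']
  intro x hx
  have hx' : (x : X) ∈ f.ker := hx
  have := Submodule.inner_right_of_mem_orthogonal hx' x.2
  exact Subtype.ext (inner_self_eq_zero.mp this)

/-- A bounded operator between Banach spaces, with Hilbert space domain, whose range has finite
codimension has closed range. -/
theorem isClosed_range_of_finiteDimensional_quotient [CompleteSpace Y] (f : X →L[ℂ] Y)
    (hf : FiniteDimensional ℂ (Y ⧸ f.range)) :
    IsClosed (f.range : Set Y) := by
  -- Restriction to the orthogonal complement of the kernel gives injectivity and keeps the range;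
  -- the finite-dimensional algebraic complement of the range is automatically closed.
  set g : f.kerᗮ →L[ℂ] Y := f ∘L f.kerᗮ.subtypeL with hg
  have hr : g.range = f.range := by
    apply le_antisymm
    · rintro _ ⟨x, rfl⟩
      exact ⟨x, rfl⟩
    · rintro _ ⟨x, rfl⟩
      obtain ⟨y, hy, h⟩ := f.exists_mem_orthogonal_ker_apply_eq x
      exact ⟨⟨y, hy⟩, h⟩
  obtain ⟨C, hC⟩ := Submodule.exists_isCompl (f.range)
  have : FiniteDimensional ℂ C :=
    LinearEquiv.finiteDimensional (Submodule.quotientEquivOfIsCompl _ C hC)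
  rw [← hr] at hC ⊢
  exact g.closed_complemented_range_of_isCompl_of_ker_eq_bot C hC C.closed_of_finiteDimensional
    f.ker_comp_subtypeL_orthogonal_ker

/-- A bounded surjection from a Hilbert space onto a Banach space has a bounded right inverse. -/
theorem hasRightInverse_of_surjective [CompleteSpace Y] (f : X →L[ℂ] Y)
    (hf : Function.Surjective f) : f.HasRightInverse := by
  have hs : (f ∘L f.kerᗮ.subtypeL).range = ⊤ := by
    rw [LinearMap.range_eq_top]
    intro y
    obtain ⟨x, rfl⟩ := hf y
    obtain ⟨y, hy, h⟩ := f.exists_mem_orthogonal_ker_apply_eq x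
    exact ⟨⟨y, hy⟩, h⟩
  let e := ContinuousLinearEquiv.ofBijective _ f.ker_comp_subtypeL_orthogonal_ker hs
  refine ⟨f.kerᗮ.subtypeL ∘L e.symm, fun y => ?_⟩
  exact e.apply_symm_apply y

/-- An operator into a Hilbert space that is bounded below on a closed subspace has a bounded left
inverse there. -/
theorem exists_leftInverse_on {F : Type*} [NormedAddCommGroup F] [InnerProductSpace ℂ F]
    [CompleteSpace F] (f : X →L[ℂ] F) (N : Submodule ℂ X) (hN : IsClosed (N : Set X)) (C : ℝ)
    (hC : ∀ n ∈ N, ‖n‖ ≤ C * ‖f n‖) : ∃ L : F →L[ℂ] X, ∀ n ∈ N, L (f n) = n := by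
  have : CompleteSpace N := hN.completeSpace_coe
  set g : N →L[ℂ] F := f ∘L N.subtypeL
  have hanti : AntilipschitzWith C.toNNReal g := by
    refine AddMonoidHomClass.antilipschitz_of_bound g fun n => (hC n n.2).trans ?_
    exact mul_le_mul_of_nonneg_right (Real.le_coe_toNNReal C) (norm_nonneg _)
  have hcl := hanti.isClosed_range g.uniformContinuous
  have : CompleteSpace (g.range) :=
    hcl.completeSpace_coe
  obtain ⟨L, hL⟩ := HasLeftInverse.of_injective_of_isClosed_range_of_closedComplement_range
    hanti.injective hcl ⟨g.range.orthogonalProjectionOnto,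
      g.range.orthogonalProjectionOnto_mem_subspace_eq_self⟩
  exact ⟨N.subtypeL ∘L L, fun n hn => congrArg Subtype.val (hL ⟨n, hn⟩)⟩

/-- The images of the kernels of an affine operator pencil `A - (z - z₀) J`, with `A` onto, under
an operator that is left invertible on `ker A`, are locally transported into each other by an
analytic family of invertible operators. -/
theorem exists_analytic_transport_ker [CompleteSpace Y]
    {F : Type*} [NormedAddCommGroup F] [NormedSpace ℂ F]
    [CompleteSpace F] (A J : X →L[ℂ] Y) (Γ : X →L[ℂ] F) (L : F →L[ℂ] X)
    (hA : Function.Surjective A) (hL : ∀ n ∈ A.ker, L (Γ n) = n) (z₀ : ℂ) :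
    ∃ (U : Set ℂ) (G : ℂ → (F →L[ℂ] F)), IsOpen U ∧ z₀ ∈ U ∧ AnalyticOnNhd ℂ G U ∧
      (∀ z ∈ U, IsUnit (G z)) ∧ G z₀ = ContinuousLinearMap.id ℂ F ∧
      ∀ z ∈ U, (A.ker.map (Γ : X →ₗ[ℂ] F)).map (G z).toLinearMap
        = (A - (z - z₀) • J).ker.map (Γ : X →ₗ[ℂ] F) := by
  obtain ⟨R, hR⟩ := A.hasRightInverse_of_surjective hA
  -- Chosen so that `A ∘ W z` is the pencil, by `A R = 1`.
  let W : ℂ → (X →L[ℂ] X) := fun z => 1 - (z - z₀) • (R ∘L J)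
  -- On `Γ n` with `n ∈ ker A` this gives `Γ (W z)⁻¹ n`; the summand `1` makes `G z₀` the identity
  -- on all of `F`.
  let G : ℂ → (F →L[ℂ] F) := fun z => 1 + Γ ∘L ((Ring.inverse (W z) - 1) ∘L L)
  have hWd : Differentiable ℂ W := by fun_prop
  have hW₀ : W z₀ = 1 := by simp [W]
  have hG₀ : G z₀ = 1 := by simp [G, hW₀]
  have hUW : IsOpen {z | IsUnit (W z)} := Units.isOpen.preimage hWd.continuous
  have hGd : DifferentiableOn ℂ G {z | IsUnit (W z)} := by
    have h1 : DifferentiableOn ℂ (fun z => Ring.inverse (W z)) {z | IsUnit (W z)} :=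
      (differentiableOn_inverse (𝕜 := ℂ) (R := X →L[ℂ] X)).comp hWd.differentiableOn
        fun z hz => hz
    exact (differentiableOn_const _).add ((differentiableOn_const _).clm_comp
      ((h1.sub (differentiableOn_const _)).clm_comp (differentiableOn_const _)))
  have hU : IsOpen ({z | IsUnit (W z)} ∩ G ⁻¹' {g | IsUnit g}) :=
    hGd.continuousOn.isOpen_inter_preimage hUW Units.isOpen
  refine ⟨_, G, hU, ⟨by simp [hW₀], by simp [hG₀]⟩,
    (hGd.mono Set.inter_subset_left).analyticOnNhd hU, fun z hz => hz.2, hG₀, ?_⟩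
  rintro z ⟨hz, -⟩
  have hz : IsUnit (W z) := hz
  have hAW : ∀ x, A (W z x) = (A - (z - z₀) • J) x := fun x => by
    simp [W, hR (J x)]
  have hGn : ∀ n ∈ A.ker, G z (Γ n) = Γ (Ring.inverse (W z) n) := fun n hn => by
    simp [G, hL n hn]
  have hWi : ∀ x, W z (Ring.inverse (W z) x) = x := fun x =>
    congrArg (fun f : X →L[ℂ] X => f x) (Ring.mul_inverse_cancel _ hz)
  have hiW : ∀ x, Ring.inverse (W z) (W z x) = x := fun x =>
    congrArg (fun f : X →L[ℂ] X => f x) (Ring.inverse_mul_cancel _ hz)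
  apply le_antisymm
  · rintro _ ⟨_, ⟨n, hn, rfl⟩, rfl⟩
    refine ⟨Ring.inverse (W z) n, ?_, (hGn n hn).symm⟩
    change (A - (z - z₀) • J) _ = 0
    rw [← hAW, hWi]
    exact hn
  · rintro _ ⟨x, hx, rfl⟩
    have hm : W z x ∈ A.ker := (hAW x).trans hx
    exact ⟨_, ⟨W z x, hm, rfl⟩, (hGn _ hm).trans (by rw [hiW]; rfl)⟩

end Hilbert

end ContinuousLinearMap

/-! ### Closed operators, symmetry and the graph norm. -/

namespace LinearPMap

variable {H : Type*} [NormedAddCommGroup H] [InnerProductSpace ℂ H]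

/-- A closed densely defined operator is the adjoint of its adjoint: this is the inclusion of the
graph of the double adjoint in that of the operator. -/
theorem IsClosed.mem_graph_of_forall_adjoint [CompleteSpace H] {S : H →ₗ.[ℂ] H} (hclosed : S.IsClosed)
    (hdense : Dense (S.domain : Set H)) {u v : H}
    (h : ∀ x : S†.domain, inner ℂ (S† x) u = inner ℂ (x : H) v) : (u, v) ∈ S.graph := by
  let G : Submodule ℂ (WithLp 2 (H × H)) :=
    S.graph.comap (WithLp.linearEquiv 2 ℂ (H × H)).toLinearMap
  have hG : _root_.IsClosed (G : Set (WithLp 2 (H × H))) :=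
    _root_.IsClosed.preimage (WithLp.prod_continuous_ofLp 2 H H) hclosed
  have : CompleteSpace G := hG.completeSpace_coe
  -- A vector orthogonal to the graph of `S` has the form `(-S† y, y)`, so the hypothesis says
  -- exactly that `(u, v)` is orthogonal to it.
  have key : (WithLp.toLp 2 (u, v)) ∈ Gᗮᗮ := by
    intro w hw
    have hw' : ∀ x : S.domain, inner ℂ (-w.fst) (x : H) = inner ℂ w.snd (S x) := by
      intro x
      have hx : WithLp.toLp 2 ((x : H), S x) ∈ G := S.mem_graph x
      have := Submodule.inner_left_of_mem_orthogonal hx hw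
      rw [WithLp.prod_inner_apply] at this
      rw [inner_neg_left]
      exact neg_eq_of_add_eq_zero_right this
    have hd := mem_adjoint_domain_of_exists w.snd ⟨_, hw'⟩
    have := h ⟨w.snd, hd⟩
    rw [adjoint_apply_eq hdense ⟨w.snd, hd⟩ hw', inner_neg_left] at this
    rw [WithLp.prod_inner_apply]
    exact (congrArg (inner ℂ w.fst u + ·) this.symm).trans (add_neg_cancel _)
  rw [Submodule.orthogonal_orthogonal] at key
  exact key

/-- Symmetry makes `⟨S x, x⟩` real, so the cross terms in the expanded squares agree. -/
theorem IsFormalAdjoint.norm_sub_smul_conj {S : H →ₗ.[ℂ] H} (hsymm : S.IsFormalAdjoint S)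
    (x : S.domain) (z : ℂ) :
    ‖S x - (starRingEnd ℂ z) • (x : H)‖ = ‖S x - z • (x : H)‖ := by
  have him : (inner ℂ (S x) (x : H)).im = 0 := by
    have h := hsymm x x
    rw [← inner_conj_symm (x : H)] at h
    exact Complex.conj_eq_iff_im.mp h.symm
  rw [← sq_eq_sq₀ (norm_nonneg _) (norm_nonneg _), @norm_sub_sq ℂ, @norm_sub_sq ℂ]
  simp [inner_smul_right, norm_smul, him]

/-- The part of the graph of `T` over the subspace `V`, as a subspace of the Hilbert sum. -/
def graphOver (T : H →ₗ.[ℂ] H) (V : Submodule ℂ H) : Submodule ℂ (WithLp 2 (H × H)) :=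
  (T.graph ⊓ V.comap (LinearMap.fst ℂ H H)).comap (WithLp.linearEquiv 2 ℂ (H × H)).toLinearMap

variable {T : H →ₗ.[ℂ] H} {V : Submodule ℂ H}

theorem isClosed_graphOver (hT : T.IsClosed) (hV : _root_.IsClosed (V : Set H)) :
    _root_.IsClosed (T.graphOver V : Set (WithLp 2 (H × H))) :=
  _root_.IsClosed.preimage (WithLp.prod_continuous_ofLp 2 H H)
    (_root_.IsClosed.inter hT (hV.preimage continuous_fst))

/-- The element of the domain given by a point of the graph. -/
def graphOverToDomain (T : H →ₗ.[ℂ] H) (V : Submodule ℂ H) : T.graphOver V →ₗ[ℂ] T.domain :=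
  LinearMap.codRestrict T.domain
    (LinearMap.fst ℂ H H ∘ₗ (WithLp.linearEquiv 2 ℂ (H × H)).toLinearMap ∘ₗ
      (T.graphOver V).subtype)
    fun w => T.mem_domain_of_mem_graph (y := w.1.snd) w.2.1

theorem apply_graphOverToDomain (w : T.graphOver V) :
    T (T.graphOverToDomain V w) = (w : WithLp 2 (H × H)).snd :=
  ((T.image_iff (T.graphOverToDomain V w).2).mpr w.2.1).symm

theorem fst_mem_of_mem_graphOver (w : T.graphOver V) : (w : WithLp 2 (H × H)).fst ∈ V := w.2.2

/-- The point of the graph given by an element of the domain that lies in `V`. -/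
def toGraphOver (x : T.domain) (hx : (x : H) ∈ V) : T.graphOver V :=
  ⟨WithLp.toLp 2 ((x : H), T x), T.mem_graph x, hx⟩

theorem graphOverToDomain_toGraphOver (x : T.domain) (hx : (x : H) ∈ V) :
    T.graphOverToDomain V (toGraphOver x hx) = x := rfl

/-- The first coordinate `(x, T x) ↦ x` on the graph over `V`. -/
def graphOverFst (T : H →ₗ.[ℂ] H) (V : Submodule ℂ H) : T.graphOver V →L[ℂ] H :=
  WithLp.fstL 2 ℂ H H ∘L (T.graphOver V).subtypeL

/-- The second coordinate `(x, T x) ↦ T x` on the graph over `V`. -/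
def graphOverSnd (T : H →ₗ.[ℂ] H) (V : Submodule ℂ H) : T.graphOver V →L[ℂ] H :=
  WithLp.sndL 2 ℂ H H ∘L (T.graphOver V).subtypeL

theorem graphOverFst_apply (w : T.graphOver V) :
    T.graphOverFst V w = T.graphOverToDomain V w := rfl

theorem graphOverSnd_apply (w : T.graphOver V) :
    T.graphOverSnd V w = T (T.graphOverToDomain V w) := (apply_graphOverToDomain w).symm

theorem norm_graphOver_le (w : T.graphOver V) :
    ‖w‖ ≤ ‖T.graphOverFst V w‖ + ‖T.graphOverSnd V w‖ := by
  have h := WithLp.prod_norm_sq_eq_of_L2 (w : WithLp 2 (H × H))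
  refine abs_le_of_sq_le_sq' ?_ (by positivity) |>.2
  change ‖(w : WithLp 2 (H × H))‖ ^ 2 ≤
    (‖(w : WithLp 2 (H × H)).fst‖ + ‖(w : WithLp 2 (H × H)).snd‖) ^ 2
  rw [h]
  nlinarith [norm_nonneg (w : WithLp 2 (H × H)).fst, norm_nonneg (w : WithLp 2 (H × H)).snd]

end LinearPMap

/-! ### Deficiency of `S* - z` and basic properties of the trace operator. -/

namespace CauchyData

variable {H : Type*} [NormedAddCommGroup H] [InnerProductSpace ℂ H]

theorem subScalar_apply (T : H →ₗ.[ℂ] H) (z : ℂ) (x : T.domain) :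
    subScalar T z x = T x - z • (x : H) := rfl

/-- For a closed operator the range of `T - z` is closed if it has finite codimension. -/
theorem isClosed_range_subScalar [CompleteSpace H] {T : H →ₗ.[ℂ] H} (hT : T.IsClosed) {z : ℂ}
    (hz : z ∈ PhiMinus T) : IsClosed (LinearMap.range (subScalar T z) : Set H) := by
  have : CompleteSpace (T.graphOver ⊤) :=
    (LinearPMap.isClosed_graphOver hT isClosed_univ).completeSpace_coe
  let A : T.graphOver ⊤ →L[ℂ] H := T.graphOverSnd ⊤ - z • T.graphOverFst ⊤
  have hA : ∀ w, A w = subScalar T z (T.graphOverToDomain ⊤ w) := fun w => by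
    simp [A, LinearPMap.graphOverFst_apply, LinearPMap.graphOverSnd_apply, subScalar_apply]
  have hr : A.range = LinearMap.range (subScalar T z) := by
    apply le_antisymm
    · rintro _ ⟨w, rfl⟩
      exact ⟨_, (hA w).symm⟩
    · rintro _ ⟨x, rfl⟩
      exact ⟨LinearPMap.toGraphOver x trivial, hA _⟩
  rw [← hr]
  refine A.isClosed_range_of_finiteDimensional_quotient ?_
  rw [hr]
  exact hz

/-- For a closed symmetric `S`, the deficiency of `S† - z` consists of eigenvectors of `S` for the
eigenvalue `z`. -/
theorem exists_apply_eq_smul_of_mem_orthogonal [CompleteSpace H] {S : H →ₗ.[ℂ] H}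
    (hclosed : S.IsClosed) (hdense : Dense (S.domain : Set H)) (hsymm : S.IsFormalAdjoint S) {z : ℂ} {p : H}
    (hp : p ∈ (LinearMap.range (subScalar S† z))ᗮ) :
    ∃ x : S.domain, (x : H) = p ∧ S x = z • p := by
  have hg : (p, starRingEnd ℂ z • p) ∈ S.graph := by
    refine hclosed.mem_graph_of_forall_adjoint hdense fun x => ?_
    have := hp _ ⟨x, rfl⟩
    rw [subScalar_apply, inner_sub_left, inner_smul_left] at this
    rw [inner_smul_right]
    exact sub_eq_zero.mp this
  obtain ⟨x, hx, hSx⟩ := (LinearPMap.mem_graph_iff S).mp hg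
  simp only at hx hSx
  refine ⟨x, hx, ?_⟩
  rw [← hx] at hSx ⊢
  -- Here `(S - conj z) x = 0`, and equality of norms forces `(S - z) x = 0`.
  have h := hsymm.norm_sub_smul_conj x z
  rw [hSx, sub_self, norm_zero] at h
  rw [hSx]
  exact sub_eq_zero.mp (norm_eq_zero.mp h.symm)

namespace BoundaryTriplet

variable [CompleteSpace H] {S : H →ₗ.[ℂ] H}
  {K : Type*} [NormedAddCommGroup K] [InnerProductSpace ℂ K]

theorem trace_fst (B : BoundaryTriplet S K) (f : S†.domain) : (B.trace f).fst = B.Γ₀ f := rfl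

theorem trace_snd (B : BoundaryTriplet S K) (f : S†.domain) : (B.trace f).snd = B.Γ₁ f := rfl

theorem trace_surjective (B : BoundaryTriplet S K) : Function.Surjective B.trace := fun w => by
  obtain ⟨f, h0, h1⟩ := B.surjective w.fst w.snd
  exact ⟨f, by rw [← WithLp.toLp_ofLp 2 w, ← WithLp.toLp_ofLp 2 (B.trace f)]
               exact congrArg _ (Prod.ext h0 h1)⟩

/-- Nondegeneracy of the boundary form: as the trace is onto, `(-w.snd, w.fst)` is an admissible
test value and turns the form into `⟨w, w⟩`. -/
theorem eq_zero_of_forall_green (B : BoundaryTriplet S K) {w : DirectSum2 K}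
    (h : ∀ g : S†.domain, inner ℂ w.fst (B.Γ₁ g) - inner ℂ w.snd (B.Γ₀ g) = 0) : w = 0 := by
  obtain ⟨g, h0, h1⟩ := B.surjective (-w.snd) w.fst
  have := h g
  rw [h0, h1, inner_neg_right, sub_neg_eq_add] at this
  exact inner_self_eq_zero.mp ((WithLp.prod_inner_apply w w).trans this)

/-- The trace operator vanishes on the domain of `S`. -/
theorem trace_eq_zero_of_mem (B : BoundaryTriplet S K) (hdense : Dense (S.domain : Set H))
    (hsymm : S.IsFormalAdjoint S) (f : S†.domain) (hf : (f : H) ∈ S.domain) : B.trace f = 0 := by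
  refine B.eq_zero_of_forall_green fun g => ?_
  have hle := hsymm.le_adjoint hdense
  have h1 : S ⟨f, hf⟩ = S† f := hle.2 rfl
  rw [trace_fst, trace_snd, ← B.green, ← h1, sub_eq_zero]
  exact ((LinearPMap.adjoint_isFormalAdjoint hdense).symm ⟨f, hf⟩ g).symm

/-- The kernel of the trace operator is contained in the domain of `S`. -/
theorem mem_domain_of_trace_eq_zero (B : BoundaryTriplet S K) (hclosed : S.IsClosed)
    (hdense : Dense (S.domain : Set H)) (f : S†.domain) (hf : B.trace f = 0) :
    (f : H) ∈ S.domain := by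
  have h0 : B.Γ₀ f = 0 := congrArg WithLp.fst hf
  have h1 : B.Γ₁ f = 0 := congrArg WithLp.snd hf
  refine S.mem_domain_of_mem_graph (y := S† f)
    (hclosed.mem_graph_of_forall_adjoint hdense fun x => ?_)
  have := B.green x f
  rw [h0, h1, inner_zero_right, inner_zero_right, sub_zero, sub_eq_zero] at this
  exact this.symm

/-- The trace operator is continuous for the graph norm. -/
theorem continuous_trace_comp_graphOverToDomain [CompleteSpace K] (B : BoundaryTriplet S K)
    (V : Submodule ℂ H) [CompleteSpace (S†.graphOver V)] :
    Continuous (B.trace ∘ₗ S†.graphOverToDomain V) := by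
  -- Closed graph theorem: Green's identity passes to the limit on both sides, and nondegeneracy
  -- identifies the limit of the traces.
  refine LinearMap.continuous_of_seq_closed_graph _ fun u x y hu hy => ?_
  rw [← sub_eq_zero]
  refine B.eq_zero_of_forall_green fun g => ?_
  have hF : Filter.Tendsto (fun n => S†.graphOverFst V (u n)) .atTop
      (nhds (S†.graphOverFst V x)) := ((S†.graphOverFst V).continuous.tendsto x).comp hu
  have hS : Filter.Tendsto (fun n => S†.graphOverSnd V (u n)) .atTop
      (nhds (S†.graphOverSnd V x)) := ((S†.graphOverSnd V).continuous.tendsto x).comp hu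
  have hy0 := ((WithLp.fstL 2 ℂ K K).continuous.tendsto y).comp hy
  have hy1 := ((WithLp.sndL 2 ℂ K K).continuous.tendsto y).comp hy
  have l1 := (hF.inner (𝕜 := ℂ) (tendsto_const_nhds (x := S† g))).sub
    (hS.inner (𝕜 := ℂ) (tendsto_const_nhds (x := (g : H))))
  have l2 := (hy0.inner (𝕜 := ℂ) (tendsto_const_nhds (x := B.Γ₁ g))).sub
    (hy1.inner (𝕜 := ℂ) (tendsto_const_nhds (x := B.Γ₀ g)))
  have heq : ∀ w, inner ℂ (S†.graphOverFst V w) (S† g) - inner ℂ (S†.graphOverSnd V w) (g : H)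
      = inner ℂ (B.Γ₀ (S†.graphOverToDomain V w)) (B.Γ₁ g)
        - inner ℂ (B.Γ₁ (S†.graphOverToDomain V w)) (B.Γ₀ g) := fun w => by
    rw [LinearPMap.graphOverSnd_apply, LinearPMap.graphOverFst_apply, B.green]
  simp only [heq] at l1
  have := tendsto_nhds_unique l2 l1
  rw [WithLp.sub_fst, WithLp.sub_snd, inner_sub_left, inner_sub_left, sub_sub_sub_comm,
    sub_eq_zero]
  exact this

end BoundaryTriplet

end CauchyData

/-! ### Reduction to the range of `S* - z₀`. -/

namespace CauchyData

section

variable {H : Type*} [NormedAddCommGroup H] [InnerProductSpace ℂ H]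

/-- The pencil `T - z` on the part of the domain of `T` in the range of `T - z₀`, with values in
that range, at `z = z₀`. -/
def reducedOperator (T : H →ₗ.[ℂ] H) (z₀ : ℂ) :
    T.graphOver (LinearMap.range (subScalar T z₀)) →L[ℂ] LinearMap.range (subScalar T z₀) :=
  (T.graphOverSnd _ - z₀ • T.graphOverFst _).codRestrict _ fun w =>
    ⟨T.graphOverToDomain _ w, by
      rw [sub_apply, smul_apply,
        LinearPMap.graphOverSnd_apply, LinearPMap.graphOverFst_apply, subScalar_apply]⟩

/-- The inclusion of the part of the domain of `T` in the range of `T - z₀` into that range. -/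
def reducedInclusion (T : H →ₗ.[ℂ] H) (z₀ : ℂ) :
    T.graphOver (LinearMap.range (subScalar T z₀)) →L[ℂ] LinearMap.range (subScalar T z₀) :=
  (T.graphOverFst _).codRestrict _ LinearPMap.fst_mem_of_mem_graphOver

theorem coe_reducedOperator_apply (T : H →ₗ.[ℂ] H) (z₀ : ℂ)
    (w : T.graphOver (LinearMap.range (subScalar T z₀))) :
    (reducedOperator T z₀ w : H) = subScalar T z₀ (T.graphOverToDomain _ w) := by
  rw [subScalar_apply, ← LinearPMap.graphOverSnd_apply]
  rfl

theorem coe_reducedPencil_apply (T : H →ₗ.[ℂ] H) (z₀ z : ℂ)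
    (w : T.graphOver (LinearMap.range (subScalar T z₀))) :
    ((reducedOperator T z₀ - (z - z₀) • reducedInclusion T z₀) w : H)
      = subScalar T z (T.graphOverToDomain _ w) := by
  change (reducedOperator T z₀ w : H) - (z - z₀) • (T.graphOverToDomain _ w : H) = _
  rw [coe_reducedOperator_apply, subScalar_apply, subScalar_apply]
  module

theorem subScalar_eigenvector {T : H →ₗ.[ℂ] H} {z₀ : ℂ} (z : ℂ) {p : T.domain}
    (hp : T p = z₀ • (p : H)) : subScalar T z p = (z₀ - z) • (p : H) := by
  rw [subScalar_apply, hp, sub_smul]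

theorem reducedPencil_self (T : H →ₗ.[ℂ] H) (z₀ : ℂ) :
    reducedOperator T z₀ - (z₀ - z₀) • reducedInclusion T z₀ = reducedOperator T z₀ := by
  ext w
  rw [coe_reducedPencil_apply, coe_reducedOperator_apply]

end

variable {H : Type*} [NormedAddCommGroup H] [InnerProductSpace ℂ H] [CompleteSpace H]
variable {S : H →ₗ.[ℂ] H}

/-- Every element of the domain of `S†` is the sum of an eigenvector of `S` for `z₀`, orthogonal
to the range of `S† - z₀`, and an element of that range. -/
theorem exists_add_eigenvector (hclosed : S.IsClosed) (hdense : Dense (S.domain : Set H))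
    (hsymm : S.IsFormalAdjoint S) {z₀ : ℂ}
    (hV : IsClosed (LinearMap.range (subScalar S† z₀) : Set H)) (f : S†.domain) :
    ∃ (g p : S†.domain), f = g + p ∧ (g : H) ∈ LinearMap.range (subScalar S† z₀) ∧
      (p : H) ∈ S.domain ∧ (p : H) ∈ (LinearMap.range (subScalar S† z₀))ᗮ ∧
      S† p = z₀ • (p : H) := by
  have : CompleteSpace (LinearMap.range (subScalar S† z₀)) := hV.completeSpace_coe
  obtain ⟨v, hv, p, hp, hvp⟩ :=
    (LinearMap.range (subScalar S† z₀)).exists_add_mem_mem_orthogonal (f : H)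
  obtain ⟨x, hx, hSx⟩ := exists_apply_eq_smul_of_mem_orthogonal hclosed hdense hsymm hp
  have hle := hsymm.le_adjoint hdense
  let p' : S†.domain := ⟨x, hle.1 x.2⟩
  have hp' : S† p' = z₀ • (p' : H) := by
    rw [← hle.2 (x := x) (y := p') rfl, hSx, ← hx]
  refine ⟨f - p', p', (sub_add_cancel f p').symm, ?_, x.2, ?_, hp'⟩
  · have : ((f - p' : S†.domain) : H) = v := by
      change (f : H) - (x : H) = v
      rw [hx, hvp, add_sub_cancel_right]
    rwa [this]
  · change (x : H) ∈ _
    rwa [hx]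

/-- The discarded component is an eigenvector for `z₀`, so `S† - z₀` kills it and already attains
its whole range on `V`. -/
theorem reducedOperator_surjective (hclosed : S.IsClosed) (hdense : Dense (S.domain : Set H))
    (hsymm : S.IsFormalAdjoint S) {z₀ : ℂ}
    (hV : IsClosed (LinearMap.range (subScalar S† z₀) : Set H)) :
    Function.Surjective (reducedOperator S† z₀) := by
  rintro ⟨_, f, rfl⟩
  obtain ⟨g, p, rfl, hg, -, -, hp⟩ := exists_add_eigenvector hclosed hdense hsymm hV f
  refine ⟨LinearPMap.toGraphOver g hg, Subtype.ext ?_⟩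
  rw [coe_reducedOperator_apply, LinearPMap.graphOverToDomain_toGraphOver]
  change _ = subScalar S† z₀ (g + p)
  rw [map_add, subScalar_eigenvector z₀ hp, sub_self, zero_smul, add_zero]

namespace BoundaryTriplet

variable {K : Type*} [NormedAddCommGroup K] [InnerProductSpace ℂ K] (B : BoundaryTriplet S K)

/-- The trace operator on the part of the domain of `S†` in the range of `S† - z₀`, with the
graph norm. -/
noncomputable def reducedTrace [CompleteSpace K] (z₀ : ℂ)
    [CompleteSpace (S†.graphOver (LinearMap.range (subScalar S† z₀)))] :
    S†.graphOver (LinearMap.range (subScalar S† z₀)) →L[ℂ] DirectSum2 K :=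
  ⟨B.trace ∘ₗ S†.graphOverToDomain _, B.continuous_trace_comp_graphOverToDomain _⟩

variable [CompleteSpace K] (z₀ : ℂ)
  [CompleteSpace (S†.graphOver (LinearMap.range (subScalar S† z₀)))]

theorem reducedTrace_apply (w : S†.graphOver (LinearMap.range (subScalar S† z₀))) :
    B.reducedTrace z₀ w = B.trace (S†.graphOverToDomain _ w) := rfl

variable {z₀}

theorem reducedTrace_surjective (hclosed : S.IsClosed) (hdense : Dense (S.domain : Set H))
    (hsymm : S.IsFormalAdjoint S)
    (hV : IsClosed (LinearMap.range (subScalar S† z₀) : Set H)) :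
    Function.Surjective (B.reducedTrace z₀) := fun y => by
  obtain ⟨f, rfl⟩ := B.trace_surjective y
  obtain ⟨g, p, rfl, hg, hpS, -, -⟩ := exists_add_eigenvector hclosed hdense hsymm hV f
  refine ⟨LinearPMap.toGraphOver g hg, ?_⟩
  rw [reducedTrace_apply, LinearPMap.graphOverToDomain_toGraphOver, map_add,
    B.trace_eq_zero_of_mem hdense hsymm p hpS, add_zero]

/-- Dropping the eigenvector component `p` from `f = g + p` leaves the trace unchanged. It also
keeps `g` in the kernel: `(S† - z) g` lies in `V`, and being a multiple of `p` it also lies in `Vᗮ`.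
-/
theorem cauchyDataSpace_eq_map_ker (hclosed : S.IsClosed) (hdense : Dense (S.domain : Set H))
    (hsymm : S.IsFormalAdjoint S)
    (hV : IsClosed (LinearMap.range (subScalar S† z₀) : Set H)) (z : ℂ) :
    B.cauchyDataSpace z = (reducedOperator S† z₀ - (z - z₀) • reducedInclusion S† z₀).ker.map
      (B.reducedTrace z₀ : _ →ₗ[ℂ] DirectSum2 K) := by
  apply le_antisymm
  · rintro _ ⟨f, hf, rfl⟩
    obtain ⟨g, p, rfl, hg, hpS, hpV, hp⟩ := exists_add_eigenvector hclosed hdense hsymm hV f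
    have hf : subScalar S† z (g + p) = 0 := hf
    rw [map_add, subScalar_eigenvector z hp] at hf
    refine ⟨LinearPMap.toGraphOver g hg, ?_, ?_⟩
    · refine Subtype.ext ?_
      change ((reducedOperator S† z₀ - (z - z₀) • reducedInclusion S† z₀) _ : H) = 0
      have hmem := ((reducedOperator S† z₀ - (z - z₀) • reducedInclusion S† z₀)
        (LinearPMap.toGraphOver g hg)).2
      rw [coe_reducedPencil_apply, LinearPMap.graphOverToDomain_toGraphOver] at hmem ⊢
      have hmem' : subScalar S† z g ∈ (LinearMap.range (subScalar S† z₀))ᗮ := by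
        rw [eq_neg_of_add_eq_zero_left hf]
        exact neg_mem (Submodule.smul_mem _ _ hpV)
      exact inner_self_eq_zero.mp (hmem' _ hmem)
    · rw [map_add, B.trace_eq_zero_of_mem hdense hsymm p hpS, add_zero]
      rfl
  · rintro _ ⟨w, hw, rfl⟩
    refine ⟨S†.graphOverToDomain _ w, ?_, rfl⟩
    change subScalar S† z _ = 0
    rw [← coe_reducedPencil_apply]
    exact congrArg Subtype.val hw

/-- On the kernel of `S† - z₀`, modulo eigenvectors of `S`, the trace operator is bounded below. -/
theorem exists_norm_le_mul_norm_reducedTrace (hclosed : S.IsClosed)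
    (hdense : Dense (S.domain : Set H)) (hsymm : S.IsFormalAdjoint S)
    (hV : IsClosed (LinearMap.range (subScalar S† z₀) : Set H)) :
    ∃ C : ℝ, ∀ n ∈ (reducedOperator S† z₀).ker, ‖n‖ ≤ C * ‖B.reducedTrace z₀ n‖ := by
  have : CompleteSpace (LinearMap.range (subScalar S† z₀)) := hV.completeSpace_coe
  obtain ⟨C₁, hC₁, h₁⟩ := (B.reducedTrace z₀).exists_preimage_norm_le
    (B.reducedTrace_surjective hclosed hdense hsymm hV)
  obtain ⟨C₂, hC₂, h₂⟩ := (reducedOperator S† z₀).exists_preimage_norm_le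
    (reducedOperator_surjective hclosed hdense hsymm hV)
  set A := reducedOperator S† z₀ with hA
  refine ⟨(1 + ‖z₀‖) * (1 + C₂ * ‖A‖) * C₁, fun n hn => ?_⟩
  have hn : A n = 0 := hn
  -- `x` has the same trace as `n` and norm controlled by it, so `n - x` lies in the domain of `S`
  -- and `(S - z₀)(n - x) = -A x`.
  obtain ⟨x, hx, hxn⟩ := h₁ (B.reducedTrace z₀ n)
  have hfst : ∀ w : S†.graphOver (LinearMap.range (subScalar S† z₀)),
      ‖S†.graphOverFst _ w‖ ≤ ‖w‖ := fun w => WithLp.norm_fst_le H (w : WithLp 2 (H × H))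
  have hs : ‖S†.graphOverFst _ (n - x)‖ ≤ C₂ * ‖A x‖ := by
    have hker : B.trace (S†.graphOverToDomain _ (n - x)) = 0 := by
      rw [← reducedTrace_apply, map_sub, hx, sub_self]
    have hmem := B.mem_domain_of_trace_eq_zero hclosed hdense _ hker
    -- With `s = n - x = (S† - z₀) y`, moving the operator across gives `‖s‖² = ⟨(S - conj z₀) s, y⟩
    -- ≤ ‖A x‖ · C₂ ‖s‖`, the conjugation being harmless for the norm.
    obtain ⟨y, hy, hyn⟩ := h₂ (reducedInclusion S† z₀ (n - x))
    have hAs : ‖A x‖ = ‖S ⟨_, hmem⟩ - z₀ • S†.graphOverFst _ (n - x)‖ := by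
      have h := coe_reducedOperator_apply S† z₀ (n - x)
      rw [← hA, map_sub, hn, zero_sub, subScalar_apply,
        ← (hsymm.le_adjoint hdense).2 (x := ⟨_, hmem⟩) rfl] at h
      rw [← norm_neg (A x)]
      exact congrArg norm h
    rw [hAs]
    have hsm := hsymm.norm_sub_smul_conj ⟨_, hmem⟩ z₀
    change _ = ‖S ⟨_, hmem⟩ - z₀ • S†.graphOverFst _ (n - x)‖ at hsm
    rw [← hsm]
    have hy' : S† (S†.graphOverToDomain _ y) - z₀ • S†.graphOverFst _ y
        = S†.graphOverFst _ (n - x) := by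
      have := congrArg Subtype.val hy
      rw [hA, coe_reducedOperator_apply] at this
      exact this
    have hinner : inner ℂ (S†.graphOverFst _ (n - x)) (S†.graphOverFst _ (n - x))
        = inner ℂ (S ⟨_, hmem⟩ - starRingEnd ℂ z₀ • S†.graphOverFst _ (n - x))
          (S†.graphOverFst _ y) := by
      nth_rw 2 [← hy']
      rw [inner_sub_right, inner_sub_left, inner_smul_right, inner_smul_left, Complex.conj_conj]
      congr 1
      exact ((LinearPMap.adjoint_isFormalAdjoint hdense).symm ⟨_, hmem⟩
        (S†.graphOverToDomain _ y)).symm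
    have hyn' : ‖S†.graphOverFst _ y‖ ≤ C₂ * ‖S†.graphOverFst _ (n - x)‖ := (hfst y).trans hyn
    have hle : ‖S†.graphOverFst _ (n - x)‖ ^ 2 ≤
        ‖S ⟨_, hmem⟩ - starRingEnd ℂ z₀ • S†.graphOverFst _ (n - x)‖
          * (C₂ * ‖S†.graphOverFst _ (n - x)‖) := by
      have := norm_inner_le_norm (𝕜 := ℂ)
        (S ⟨_, hmem⟩ - starRingEnd ℂ z₀ • S†.graphOverFst _ (n - x)) (S†.graphOverFst _ y)
      rw [← hinner, inner_self_eq_norm_sq_to_K, norm_pow, RCLike.norm_ofReal, abs_norm] at this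
      exact this.trans (mul_le_mul_of_nonneg_left hyn' (norm_nonneg _))
    rcases (norm_nonneg (S†.graphOverFst _ (n - x))).eq_or_lt with h0 | h0
    · rw [← h0]
      positivity
    · refine le_of_mul_le_mul_right ?_ h0
      change _ ≤ C₂ * ‖S ⟨_, hmem⟩ - starRingEnd ℂ z₀ • S†.graphOverFst _ (n - x)‖ * _
      linarith
  -- On `ker A` the graph norm is at most `1 + ‖z₀‖` times the norm of `H`.
  have hsnd : S†.graphOverSnd _ n = z₀ • S†.graphOverFst _ n :=
    sub_eq_zero.mp (congrArg Subtype.val hn)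
  have hAx : ‖A x‖ ≤ ‖A‖ * ‖x‖ := A.le_opNorm x
  have hnf : ‖S†.graphOverFst _ n‖ ≤ (1 + C₂ * ‖A‖) * ‖x‖ := by
    calc ‖S†.graphOverFst _ n‖ = ‖S†.graphOverFst _ x + S†.graphOverFst _ (n - x)‖ := by
          rw [← map_add, add_sub_cancel]
      _ ≤ ‖x‖ + C₂ * (‖A‖ * ‖x‖) := (norm_add_le _ _).trans (add_le_add (hfst x)
          (hs.trans (mul_le_mul_of_nonneg_left hAx hC₂.le)))
      _ = (1 + C₂ * ‖A‖) * ‖x‖ := by ring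
  calc ‖n‖ ≤ ‖S†.graphOverFst _ n‖ + ‖S†.graphOverSnd _ n‖ := LinearPMap.norm_graphOver_le n
    _ = (1 + ‖z₀‖) * ‖S†.graphOverFst _ n‖ := by rw [hsnd, norm_smul]; ring
    _ ≤ (1 + ‖z₀‖) * ((1 + C₂ * ‖A‖) * (C₁ * ‖B.reducedTrace z₀ n‖)) := by
      gcongr
      exact hnf.trans (by gcongr)
    _ = (1 + ‖z₀‖) * (1 + C₂ * ‖A‖) * C₁ * ‖B.reducedTrace z₀ n‖ := by ring

end BoundaryTriplet

end CauchyData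

theorem theorem4p1
    {H : Type*} [NormedAddCommGroup H] [InnerProductSpace ℂ H] [CompleteSpace H]
    {K : Type*} [NormedAddCommGroup K] [InnerProductSpace ℂ K] [CompleteSpace K]
    (S : H →ₗ.[ℂ] H) (hclosed : S.IsClosed) (hdense : Dense (S.domain : Set H))
    (hsymm : S.IsFormalAdjoint S) (hdefect : CauchyData.EqualDefectNumbers S)
    (B : CauchyData.BoundaryTriplet S K)
    (z₀ : ℂ) (hz₀ : z₀ ∈ CauchyData.PhiMinus S†) :
    ∃ (U : Set ℂ) (G : ℂ → (CauchyData.DirectSum2 K →L[ℂ] CauchyData.DirectSum2 K)),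
      IsOpen U ∧ z₀ ∈ U ∧ AnalyticOnNhd ℂ G U ∧
      (∀ z ∈ U, IsUnit (G z)) ∧
      G z₀ = ContinuousLinearMap.id ℂ (CauchyData.DirectSum2 K) ∧
      ∀ z ∈ U, (B.cauchyDataSpace z₀).map (G z).toLinearMap = B.cauchyDataSpace z := by
  have hT := LinearPMap.adjoint_isClosed hdense
  have hV := CauchyData.isClosed_range_subScalar hT hz₀
  have : CompleteSpace (LinearMap.range (CauchyData.subScalar S† z₀)) := hV.completeSpace_coe
  have : CompleteSpace (S†.graphOver (LinearMap.range (CauchyData.subScalar S† z₀))) :=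
    (LinearPMap.isClosed_graphOver hT hV).completeSpace_coe
  obtain ⟨C, hC⟩ := B.exists_norm_le_mul_norm_reducedTrace hclosed hdense hsymm hV
  obtain ⟨L, hL⟩ := (B.reducedTrace z₀).exists_leftInverse_on
    (CauchyData.reducedOperator S† z₀).ker (CauchyData.reducedOperator S† z₀).isClosed_ker C hC
  obtain ⟨U, G, hU, hzU, hG, hunit, hid, hmap⟩ :=
    ContinuousLinearMap.exists_analytic_transport_ker (CauchyData.reducedOperator S† z₀)
      (CauchyData.reducedInclusion S† z₀) (B.reducedTrace z₀) L
      (CauchyData.reducedOperator_surjective hclosed hdense hsymm hV) hL z₀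
  refine ⟨U, G, hU, hzU, hG, hunit, hid, fun z hz => ?_⟩
  have h₀ := B.cauchyDataSpace_eq_map_ker hclosed hdense hsymm hV z₀
  rw [CauchyData.reducedPencil_self] at h₀
  rw [h₀, B.cauchyDataSpace_eq_map_ker hclosed hdense hsymm hV z]
  exact hmap z hz
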